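/- Let $M$ be an open (complete, noncompact, connected, without boundary) smooth Riemannian $n$-manifold with $\mathrm{Ric}_M\ge 0$, let $\pi:\widetilde M\to M$ be its Riemannian universal cover, $\tilde p\in\widetilde M$, $p=\pi(\tilde p)$, and let $\Gamma=\pi_1(M,p)$ act isometrically on $\widetilde M$ by path lifting. Suppose that $\Gamma$ has an infinite sequence of short generators $\gamma_1,\gamma_2,\dots$; that is, for every $i\ge 1$, $\gamma_i\notin\langle\gamma_1,\dots,\gamma_{i-1}\rangle$ and $$d(\gamma_i\tilde p,\tilde p)\le d(\gamma\tilde p,\tilde p)\quad\text{for all }\gamma\in\Gamma\setminus\langle\gamma_1,\dots,\gamma_{i-1}\rangle ,$$ where for $i=1$ the subgroup $\langle\gamma_1,\dots,\gamma_{i-1}\rangle$ is $\{e\}$. Put $r_i=d(\gamma_i\tilde p,\tilde p)$. Let $(\widetilde Y,\tilde y)$ be a pointed proper metric space and $G$ a closed subgroup of $\mathrm{Isom}(\widetilde Y)$ (with the compact-open topology), and suppose that some subsequence $(r_{i_j}^{-1}\widetilde M,\tilde p,\Gamma)$ converges to $(\widetilde Y,\tilde y,G)$ in the pointed equivariant Gromov-Hausdorff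 topology of Fukaya and Yamaguchi, realized by equivariant $\varepsilon_j$-approximations $(f_j,\varphi_j,\psi_j)$ with $\varepsilon_j\to 0$. Then: 1. $r_i\to\infty$; 2. the orbit $G\cdot\tilde y$ is not connected; 3. after passing to a further subsequence, the elements $\gamma_{i_j}$ converge to some $g\in G$, meaning that $f_j\circ\gamma_{i_j}$ and $g\circ f_j$ become uniformly close on every ball of fixed radius around $\tilde p$ in $r_{i_j}^{-1}\widetilde M$; 4. whenever the elements $\gamma_{i_j}$ converge in this sense, along a further subsequence, to some $g\in G$, one has $d(g\tilde y,\,G_0\cdot\tilde y)\ge 1$, where $G_0$ is the connected component of $G$ containing the identity. -/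

import Mathlib

open Set Filter Topology Bundle
open scoped Manifold ContDiff

noncomputable section

/-! ### Ricci curvature in coordinates -/

section Ricci

variable {n : ℕ} {M : Type*} [TopologicalSpace M] [ChartedSpace (EuclideanSpace ℝ (Fin n)) M]
  [RiemannianBundle (fun x : M => TangentSpace (𝓡 n) x)]

/-- Partial derivative `∂f/∂uⁱ` of a function on `ℝⁿ`. -/
def partialDeriv (i : Fin n) (f : EuclideanSpace ℝ (Fin n) → ℝ)
    (u : EuclideanSpace ℝ (Fin n)) : ℝ :=
  fderiv ℝ f u (EuclideanSpace.single i 1)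

/-- The coordinate vector field `∂/∂uⁱ` of the preferred chart at `x`, at the point of `M` with
coordinates `u`. -/
def coordVec (x : M) (i : Fin n) (u : EuclideanSpace ℝ (Fin n)) :
    TangentSpace (𝓡 n) ((extChartAt (𝓡 n) x).symm u) :=
  mfderiv 𝓘(ℝ, EuclideanSpace ℝ (Fin n)) (𝓡 n) (extChartAt (𝓡 n) x).symm u
    (EuclideanSpace.single i (1 : ℝ))

/-- The matrix `(gᵢⱼ)` of the Riemannian metric in the preferred chart at `x`, as a function of the
coordinates `u`. -/
def metricMatrix (x : M) (u : EuclideanSpace ℝ (Fin n)) : Matrix (Fin n) (Fin n) ℝ :=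
  Matrix.of fun i j => inner ℝ (coordVec x i u) (coordVec x j u)

/-- The Christoffel symbol `Γᵏᵢⱼ = ½ ∑ₗ gᵏˡ (∂ᵢ gⱼₗ + ∂ⱼ gᵢₗ - ∂ₗ gᵢⱼ)` of the Levi-Civita
connection in the preferred chart at `x`. -/
def christoffel (x : M) (k i j : Fin n) (u : EuclideanSpace ℝ (Fin n)) : ℝ :=
  (1 / 2) * ∑ l, (metricMatrix x u)⁻¹ k l *
    (partialDeriv i (fun w => metricMatrix x w j l) u
      + partialDeriv j (fun w => metricMatrix x w i l) u
      - partialDeriv l (fun w => metricMatrix x w i j) u)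

/-- The components at `x`, in the preferred chart at `x`, of the Ricci tensor:
`Ricⱼₖ = ∑ᵢ (∂ᵢ Γⁱⱼₖ - ∂ⱼ Γⁱᵢₖ) + ∑ᵢₚ (Γⁱᵢₚ Γᵖⱼₖ - Γⁱⱼₚ Γᵖᵢₖ)`. -/
def ricci (x : M) (j k : Fin n) : ℝ :=
  let u := extChartAt (𝓡 n) x x
  ∑ i, (partialDeriv i (christoffel x i j k) u - partialDeriv j (christoffel x i i k) u)
    + ∑ i, ∑ p, (christoffel x i i p u * christoffel x p j k u
        - christoffel x i j p u * christoffel x p i k u)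

variable (n M) in
/-- `Ric_M ≥ 0`: the Ricci tensor is positive semidefinite at every point. -/
def RicciNonneg : Prop :=
  ∀ (x : M) (v : Fin n → ℝ), 0 ≤ ∑ j, ∑ k, ricci x j k * v j * v k

end Ricci

/-! ### Riemannian coverings and the action of the fundamental group -/

/-- `pr : M' → M` is a Riemannian covering: a surjective smooth covering map which is a local
diffeomorphism and whose differential preserves the Riemannian norm. (If `M'` is moreover simply
connected, this is the Riemannian universal cover.) -/
structure IsRiemannianCovering (n : ℕ) {M M' : Type*}
    [TopologicalSpace M] [ChartedSpace (EuclideanSpace ℝ (Fin n)) M]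
    [RiemannianBundle (fun x : M => TangentSpace (𝓡 n) x)]
    [TopologicalSpace M'] [ChartedSpace (EuclideanSpace ℝ (Fin n)) M']
    [RiemannianBundle (fun x : M' => TangentSpace (𝓡 n) x)] (pr : M' → M) : Prop where
  isCoveringMap : IsCoveringMap pr
  surjective : Function.Surjective pr
  isLocalDiffeomorph : IsLocalDiffeomorph (𝓡 n) (𝓡 n) ∞ pr
  norm_mfderiv : ∀ (x : M') (v : TangentSpace (𝓡 n) x), ‖mfderiv (𝓡 n) (𝓡 n) pr x v‖ = ‖v‖

/-- The action of `γ ∈ π₁(M, pr p')` on the universal cover by path lifting: choose a path `α` from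
`p'` to `x`; then `γ · x` is the endpoint of the lift, starting at `p'`, of the concatenation of
`γ` followed by `pr ∘ α`. In particular `γ · p'` is the endpoint of the lift of `γ` at `p'`.
The multiplication of `FundamentalGroup` is concatenation in the reverse order, so products of
loops act in reverse order; the subgroups of the two opposite groups are the same sets. -/
def deckAct {M M' : Type*} [TopologicalSpace M] [TopologicalSpace M'] [SimplyConnectedSpace M']
    {pr : M' → M} (hpr : IsCoveringMap pr) (p' : M') (γ : FundamentalGroup M (pr p')) (x : M') : M' :=
  hpr.monodromy
    (γ.toPath.trans ((Path.Homotopic.Quotient.mk (PathConnectedSpace.somePath p' x)).map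
      ⟨pr, hpr.continuous⟩)) ⟨p', rfl⟩

/-- An infinite sequence `γ 0, γ 1, …` of short generators of a group, with respect to the
displacement function `disp`: `γ i` does not lie in the subgroup generated by its predecessors, and
has minimal displacement among all elements outside of that subgroup. -/
def IsShortGenerators {Γ : Type*} [Group Γ] (disp : Γ → ℝ) (γ : ℕ → Γ) : Prop :=
  ∀ i, γ i ∉ Subgroup.closure (γ '' Iio i) ∧
    ∀ δ, δ ∉ Subgroup.closure (γ '' Iio i) → disp (γ i) ≤ disp δ

/-! ### Isometry groups -/

/-- The compact-open topology on the isometry group. -/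
instance isometryGroupTopology {Y : Type*} [MetricSpace Y] : TopologicalSpace (Y ≃ᵢ Y) :=
  TopologicalSpace.induced (fun g => (⟨g, g.continuous⟩ : C(Y, Y))) inferInstance

/-- The identity component `G₀` of a group `G` of isometries. -/
def identityComponent {Y : Type*} [MetricSpace Y] (G : Subgroup (Y ≃ᵢ Y)) : Set (Y ≃ᵢ Y) :=
  connectedComponentIn (G : Set (Y ≃ᵢ Y)) 1

/-- The orbit `S · y` of a point under a set of isometries. -/
def isometryOrbit {Y : Type*} [MetricSpace Y] (S : Set (Y ≃ᵢ Y)) (y : Y) : Set Y :=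
  (fun g : Y ≃ᵢ Y => g y) '' S

/-! ### Equivariant pointed Gromov-Hausdorff convergence -/

/-- An `ε`-equivariant pointed Gromov-Hausdorff approximation (Fukaya-Yamaguchi) from
`(lam • X, p, Γ)` to `(Y, q, G)`. Here `lam • X` is `X` with the metric `lam * dist`, the group `Γ`
acts on `X` through `act`, and with `Γ(R) = {γ | d(γ p, p) < R}` and likewise `G(R)` the data are
maps `f : B_p(1/ε) → Y`, `φ : Γ(1/ε) → G(1/ε)`, `ψ : G(1/ε) → Γ(1/ε)`; their values outside of
these domains are irrelevant. -/
structure EquivariantApprox {X Γ Y : Type*} [MetricSpace X] [MetricSpace Y]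
    (lam : ℝ) (act : Γ → X → X) (p : X) (G : Subgroup (Y ≃ᵢ Y)) (q : Y) (ε : ℝ) where
  f : X → Y
  φ : Γ → (Y ≃ᵢ Y)
  ψ : (Y ≃ᵢ Y) → Γ
  φ_mem : ∀ γ, lam * dist (act γ p) p < 1 / ε → φ γ ∈ G ∧ dist (φ γ q) q < 1 / ε
  ψ_mem : ∀ g ∈ G, dist (g q) q < 1 / ε → lam * dist (act (ψ g) p) p < 1 / ε
  map_base : f p = q
  almost_surjective : ∀ y, dist y q < 1 / ε → ∃ x, lam * dist x p < 1 / ε ∧ dist y (f x) < ε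
  almost_isometric : ∀ x x', lam * dist x p < 1 / ε → lam * dist x' p < 1 / ε →
    |dist (f x) (f x') - lam * dist x x'| < ε
  φ_equivariant : ∀ γ x, lam * dist (act γ p) p < 1 / ε → lam * dist x p < 1 / ε →
    lam * dist (act γ x) p < 1 / ε → dist (f (act γ x)) (φ γ (f x)) < ε
  ψ_equivariant : ∀ g ∈ G, ∀ x, dist (g q) q < 1 / ε → lam * dist x p < 1 / ε →
    lam * dist (act (ψ g) x) p < 1 / ε → dist (f (act (ψ g) x)) (g (f x)) < ε

/-- Along a sequence of approximations from `(lam j • X, p, Γ)` to `(Y, q, G)`, the elements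
`γ j ∈ Γ` converge to the isometry `g` of `Y`: the maps `f j ∘ γ j` and `g ∘ f j` become uniformly
close on every ball of fixed radius in `lam j • X` around `p`. -/
def ElementsConverge {X Γ Y : Type*} [MetricSpace X] [MetricSpace Y]
    {lam : ℕ → ℝ} {act : Γ → X → X} {p : X} {G : Subgroup (Y ≃ᵢ Y)} {q : Y} {ε : ℕ → ℝ}
    (A : ∀ j, EquivariantApprox (lam j) act p G q (ε j)) (γ : ℕ → Γ) (g : Y ≃ᵢ Y) : Prop :=
  ∀ R > 0, ∀ δ > 0, ∀ᶠ j in atTop, ∀ x, lam j * dist x p < R →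
    dist ((A j).f (act (γ j) x)) (g ((A j).f x)) < δ

end

/-!
Write `H i` for the subgroup generated by the short generators preceding `γ i`. Two elements of the
fundamental group whose orbit points have distance less than `r i` lie in the same coset of `H i`,
because their quotient has displacement less than `r i` and `γ i` has minimal displacement outside
of `H i`. After rescaling by `(r i)⁻¹`, distinct cosets have distance at least `1`.

This survives in the limit. Let `S` be a connected subset of the orbit `G · y` that contains `y`.
Any two of its points are joined by a chain in `S` with steps shorter than `1`. Pulling such a chain
back to the fundamental group by the maps `ψ j` gives, for large `j`, a chain that starts at the
identity and never leaves `H (k j)`. As `γ (k j)` is not in `H (k j)`, a limit `g` of these elements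
satisfies `d(g y, S) ≥ 1` (`IsIsometricRightAction.one_le_dist_of_isPreconnected`). With `S` the
orbit of the identity component this is the distance estimate, and with `S = G · y` it shows that
`G · y` is not connected, once a limit `g` is known to exist. The limit is obtained by applying the
Arzelà-Ascoli theorem to the isometries `φ j (γ (k j))`, which move `y` by a bounded amount
(`IsIsometricRightAction.exists_subseq_elementsConverge`).

Distinct short generators have orbit points at distance at least `r 0 > 0`. If `r` were bounded,
a single approximation would carry all of these orbit points to a separated infinite subset of a
ball in the proper space `Y`; hence `r` tends to infinity
(`IsIsometricRightAction.tendsto_displacement_atTop`).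

The geometric input is that the path lifting action is an action by isometries, free at the base
point (`isIsometricRightAction_deckAct`, `eq_one_of_deckAct_eq`). An element acts as a continuous
lift of the covering map through itself, which is smooth and preserves the norm of tangent vectors
because the covering map does, and therefore the length of paths.
-/

/-! ### Sequential compactness in the isometry group of a proper space -/

/-- This is the Arzelà-Ascoli theorem: isometries are equicontinuous, and they map a point `z` to
within `dist z y + C` of `y`. -/
theorem isCompact_setOf_isometry_dist_le {Y : Type*} [MetricSpace Y] [ProperSpace Y] (y : Y)
    (C : ℝ) : IsCompact {a : C(Y, Y) | Isometry a ∧ dist (a y) y ≤ C} := by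
  apply ArzelaAscoli.isCompact_of_equicontinuous
  · have himage : ContinuousMap.toFun '' {a : C(Y, Y) | Isometry a ∧ dist (a y) y ≤ C}
        = {a : Y → Y | Isometry a ∧ dist (a y) y ≤ C} := by
      ext a
      constructor
      · rintro ⟨b, hb, rfl⟩
        exact hb
      · intro ha
        exact ⟨⟨a, ha.1.continuous⟩, ha, rfl⟩
    rw [himage]
    have hK : IsCompact (Set.univ.pi fun z : Y => Metric.closedBall y (dist z y + C)) :=
      isCompact_univ_pi fun z => isCompact_closedBall _ _
    refine hK.of_isClosed_subset ?_ ?_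
    · have hset : {a : Y → Y | Isometry a ∧ dist (a y) y ≤ C}
          = (⋂ (u : Y) (v : Y), {a : Y → Y | dist (a u) (a v) = dist u v})
            ∩ {a : Y → Y | dist (a y) y ≤ C} := by
        ext a
        simp [isometry_iff_dist_eq]
      rw [hset]
      refine (isClosed_iInter fun u => isClosed_iInter fun v => ?_).inter ?_
      · exact isClosed_eq (by fun_prop) continuous_const
      · exact isClosed_le (by fun_prop) continuous_const
    · intro a ha z _
      have h1 := dist_triangle (a z) (a y) y
      rw [ha.1.dist_eq] at h1
      exact Metric.mem_closedBall.2 (h1.trans (by linarith [ha.2]))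
  · refine LipschitzWith.uniformEquicontinuous _ 1 (fun a => ?_) |>.equicontinuous
    exact a.2.1.lipschitz

/-- A sequence of isometries of a proper space which moves a point a bounded distance has a
subsequence that converges in the isometry group. -/
theorem exists_subseq_tendsto_isometryEquiv {Y : Type*} [MetricSpace Y] [ProperSpace Y] (y : Y)
    (C : ℝ) (u : ℕ → Y ≃ᵢ Y) (hu : ∀ᶠ j in atTop, dist (u j y) y ≤ C) :
    ∃ (g : Y ≃ᵢ Y) (s : ℕ → ℕ), StrictMono s ∧ Tendsto (u ∘ s) atTop (𝓝 g) := by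
  have hK := isCompact_setOf_isometry_dist_le y C
  -- Pairing each isometry with its inverse makes the limit invertible.
  obtain ⟨⟨a, b⟩, ⟨ha, hb⟩, s, hs, hlim⟩ := (hK.prod hK).tendsto_subseq'
    (x := fun j => ((⟨u j, (u j).continuous⟩ : C(Y, Y)),
      (⟨(u j).symm, (u j).symm.continuous⟩ : C(Y, Y))))
    (by
      refine Eventually.frequently
        (hu.mono fun j hj => ⟨⟨(u j).isometry, hj⟩, (u j).symm.isometry, ?_⟩)
      change dist ((u j).symm y) y ≤ C
      rw [← (u j).dist_eq, (u j).apply_symm_apply, dist_comm]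
      exact hj)
  have hlima : Tendsto (fun j => (⟨u (s j), (u (s j)).continuous⟩ : C(Y, Y))) atTop (𝓝 a) :=
    (continuous_fst.tendsto _).comp hlim
  have hlimb : Tendsto (fun j => (⟨(u (s j)).symm, (u (s j)).symm.continuous⟩ : C(Y, Y))) atTop
      (𝓝 b) := (continuous_snd.tendsto _).comp hlim
  have hpa : ∀ z, Tendsto (fun j => u (s j) z) atTop (𝓝 (a z)) := fun z =>
    ((continuous_eval_const z).tendsto a).comp hlima
  have hpb : ∀ z, Tendsto (fun j => (u (s j)).symm z) atTop (𝓝 (b z)) := fun z =>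
    ((continuous_eval_const z).tendsto b).comp hlimb
  have hab : ∀ z, a (b z) = z := fun z => by
    have h1 : Tendsto (fun j => dist (u (s j) (b z)) z) atTop (𝓝 (dist (a (b z)) z)) :=
      (hpa (b z)).dist tendsto_const_nhds
    have h2 : Tendsto (fun j => dist (u (s j) (b z)) z) atTop (𝓝 (dist (b z) (b z))) := by
      refine (tendsto_const_nhds.dist (hpb z)).congr fun j => ?_
      rw [← (u (s j)).dist_eq, (u (s j)).apply_symm_apply]
    exact dist_eq_zero.1 ((tendsto_nhds_unique h1 h2).trans (dist_self _))
  refine ⟨IsometryEquiv.mk' a b hab ha.1, s, hs, ?_⟩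
  rw [nhds_induced, tendsto_comap_iff]
  exact hlima

/-! ### Chains in connected sets -/

/-- Any property which passes to points of `S` at distance less than `δ` holds on all of the
preconnected set `S` as soon as it holds at one of its points. -/
theorem IsPreconnected.induction_dist_lt {Y : Type*} [PseudoMetricSpace Y] {S : Set Y}
    (hS : IsPreconnected S) {δ : ℝ} (hδ : 0 < δ) {P : Y → Prop} {a : Y} (ha : a ∈ S) (hPa : P a)
    (hstep : ∀ u ∈ S, ∀ v ∈ S, dist u v < δ → P u → P v) {b : Y} (hb : b ∈ S) : P b := by
  refine hS.induction₂' (fun u v => P u → P v) (fun u hu => ?_)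
    (fun _ _ _ _ _ _ h1 h2 => h2 ∘ h1) ha hb hPa
  filter_upwards [self_mem_nhdsWithin, mem_nhdsWithin_of_mem_nhds (Metric.ball_mem_nhds u hδ)]
    with v hv hvu
  exact ⟨hstep u hu v hv (by rwa [dist_comm]), hstep v hv u hu hvu⟩

/-! ### Short generators of a group of isometries -/

theorem IsShortGenerators.monotone {Γ : Type*} [Group Γ] {disp : Γ → ℝ} {γ : ℕ → Γ}
    (hγ : IsShortGenerators disp γ) : Monotone fun i => disp (γ i) := fun i j hij =>
  (hγ i).2 _ fun hmem => (hγ j).1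
    (Subgroup.closure_mono (image_mono (Iio_subset_Iio hij)) hmem)

/-- `act` is an action of the group `Γ` by isometries in which products act in reverse order. -/
structure IsIsometricRightAction {Γ X : Type*} [Group Γ] [MetricSpace X] (act : Γ → X → X) :
    Prop where
  one : ∀ x, act 1 x = x
  mul : ∀ a b x, act (a * b) x = act b (act a x)
  isometry : ∀ a, Isometry (act a)

namespace IsIsometricRightAction

variable {Γ X : Type*} [Group Γ] [MetricSpace X] {act : Γ → X → X}

theorem dist_act_act (h : IsIsometricRightAction act) (a b : Γ) (p : X) :
    dist (act a p) (act b p) = dist (act (b * a⁻¹) p) p := by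
  rw [← (h.isometry a⁻¹).dist_eq, ← h.mul, ← h.mul, mul_inv_cancel, h.one, dist_comm]

/-- The quotient of two short generators is not in the subgroup generated by the predecessors of
the later one, so its displacement is at least that of the later one. -/
theorem displacement_le_dist (h : IsIsometricRightAction act) {p : X} {γ : ℕ → Γ}
    (hγ : IsShortGenerators (fun δ => dist (act δ p) p) γ) {i j : ℕ} (hij : i < j) :
    dist (act (γ j) p) p ≤ dist (act (γ i) p) (act (γ j) p) := by
  rw [h.dist_act_act]
  refine (hγ j).2 _ fun hmem => (hγ j).1 ?_
  have hi : γ i ∈ Subgroup.closure (γ '' Iio j) :=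
    Subgroup.subset_closure (mem_image_of_mem γ hij)
  simpa using mul_mem hmem hi

end IsIsometricRightAction

/-! ### Short generators and equivariant convergence -/

namespace IsIsometricRightAction

variable {Γ X Y : Type*} [Group Γ] [MetricSpace X] [MetricSpace Y] {act : Γ → X → X} {p : X}
  {γ : ℕ → Γ} {r : ℕ → ℝ} {G : Subgroup (Y ≃ᵢ Y)} {y : Y} {κ : ℕ → ℕ} {ε : ℕ → ℝ}

/-- Infinitely many short generators have unbounded displacements, since their orbit points are
`r 0`-separated while some rescaling of a ball is close to a bounded part of a proper space. -/
theorem tendsto_displacement_atTop [ProperSpace Y] (h : IsIsometricRightAction act)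
    (hγ : IsShortGenerators (fun δ => dist (act δ p) p) γ)
    (hr : ∀ i, r i = dist (act (γ i) p) p) (hr0 : 0 < r 0)
    (hε : ∀ j, 0 < ε j) (hε0 : Tendsto ε atTop (𝓝 0))
    (A : ∀ j, EquivariantApprox (r (κ j))⁻¹ act p G y (ε j)) : Tendsto r atTop atTop := by
  have hmono : Monotone r := by
    intro i j hij
    rw [hr, hr]
    exact hγ.monotone hij
  refine tendsto_atTop_atTop_of_monotone hmono ?_
  by_contra! hbdd
  obtain ⟨R, hR⟩ := hbdd
  have hRpos : 0 < R := hr0.trans (hR 0)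
  have hquot : 0 < r 0 / R := div_pos hr0 hRpos
  -- The error is small enough for the rescaled orbit points to stay separated in `Y`, and for all
  -- of them to lie in the domain of the approximation, as `R / r 0 < 1 / ε j`.
  obtain ⟨j, hj⟩ := (hε0.eventually (gt_mem_nhds (half_pos hquot))).exists
  have hκ : 0 < r (κ j) := hr0.trans_le (hmono (Nat.zero_le _))
  have hdom : ∀ i, (r (κ j))⁻¹ * dist (act (γ i) p) p < 1 / ε j := by
    intro i
    have h1 : (r (κ j))⁻¹ * dist (act (γ i) p) p ≤ R / r 0 := by
      rw [← hr, inv_mul_eq_div]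
      exact div_le_div₀ hRpos.le (hR i).le hr0 (hmono (Nat.zero_le _))
    have h2 : R / r 0 < 1 / ε j := by
      rw [← one_div_div]
      exact one_div_lt_one_div_of_lt (hε j) (by linarith)
    exact h1.trans_lt h2
  have hbase : (r (κ j))⁻¹ * dist p p < 1 / ε j := by simpa using hε j
  obtain ⟨z, -, s, hs, hlim⟩ := tendsto_subseq_of_bounded (Metric.isBounded_ball (x := y)
    (r := 1 / ε j + ε j)) (x := fun i => (A j).f (act (γ i) p)) fun i => by
      have h1 := abs_lt.1 ((A j).almost_isometric _ _ (hdom i) hbase)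
      rw [(A j).map_base] at h1
      exact Metric.mem_ball.2 (by linarith [hdom i])
  obtain ⟨N, hN⟩ := Metric.cauchySeq_iff'.1 hlim.cauchySeq (r 0 / R / 2) (half_pos hquot)
  have hclose := hN (N + 1) (Nat.le_succ N)
  have hlt : s N < s (N + 1) := hs (Nat.lt_succ_self N)
  have hsep : r 0 / R ≤ (r (κ j))⁻¹ * dist (act (γ (s (N + 1))) p) (act (γ (s N)) p) := by
    have h1 := h.displacement_le_dist hγ hlt
    rw [← hr, dist_comm] at h1
    rw [inv_mul_eq_div]
    exact div_le_div₀ dist_nonneg ((hmono (Nat.zero_le _)).trans h1) hκ (hR _).le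
  have h1 := abs_lt.1 ((A j).almost_isometric _ _ (hdom (s (N + 1))) (hdom (s N)))
  simp only [Function.comp_apply] at hclose
  linarith

/-- The short generators subconverge: their almost images under the approximations move `y` by at
most `2`, so a subsequence of them converges, and the limit is in the closed group `G`. -/
theorem exists_subseq_elementsConverge [ProperSpace Y] (h : IsIsometricRightAction act)
    (hr : ∀ i, r i = dist (act (γ i) p) p) (hrpos : ∀ i, 0 < r i)
    (hG : IsClosed (G : Set (Y ≃ᵢ Y)))
    (hε : ∀ j, 0 < ε j) (hε0 : Tendsto ε atTop (𝓝 0))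
    (A : ∀ j, EquivariantApprox (r (κ j))⁻¹ act p G y (ε j)) :
    ∃ s : ℕ → ℕ, StrictMono s ∧ ∃ g ∈ G,
      ElementsConverge (fun j => A (s j)) (fun j => γ (κ (s j))) g := by
  have hinv : Tendsto (fun j => 1 / ε j) atTop atTop := by
    simp only [one_div]
    exact (tendsto_nhdsWithin_iff.2 ⟨hε0, Eventually.of_forall hε⟩).inv_tendsto_nhdsGT_zero
  have hone : ∀ j, (r (κ j))⁻¹ * dist (act (γ (κ j)) p) p = 1 := fun j => by
    rw [← hr, inv_mul_cancel₀ (hrpos _).ne']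
  have hbase : ∀ j, (r (κ j))⁻¹ * dist p p < 1 / ε j := fun j => by simpa using hε j
  have hlarge : ∀ᶠ j in atTop, 1 < 1 / ε j := hinv.eventually_gt_atTop 1
  have hbdd : ∀ᶠ j in atTop, dist ((A j).φ (γ (κ j)) y) y ≤ 2 := by
    filter_upwards [hlarge, hε0.eventually (gt_mem_nhds (half_pos one_pos))] with j hj hj2
    have hdom : (r (κ j))⁻¹ * dist (act (γ (κ j)) p) p < 1 / ε j := by rwa [hone]
    have h1 := abs_lt.1 ((A j).almost_isometric _ _ hdom (hbase j))
    have h2 := (A j).φ_equivariant _ _ hdom (hbase j) hdom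
    rw [hone] at h1
    rw [(A j).map_base] at h1 h2
    rw [dist_comm] at h2
    linarith [dist_triangle ((A j).φ (γ (κ j)) y) ((A j).f (act (γ (κ j)) p)) y]
  obtain ⟨g, s, hs, hlim⟩ := exists_subseq_tendsto_isometryEquiv y 2 _ hbdd
  have hs' := hs.tendsto_atTop
  refine ⟨s, hs, g, ?_, ?_⟩
  · refine hG.mem_of_tendsto hlim ((hs'.eventually hlarge).mono fun j hj => ?_)
    exact ((A (s j)).φ_mem _ (by rwa [hone])).1
  · intro R hR δ hδ
    have hlim' := ContinuousMap.tendsto_iff_forall_isCompact_tendstoUniformlyOn.1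
      (tendsto_comap_iff.1 (nhds_induced (fun g : Y ≃ᵢ Y => (⟨g, g.continuous⟩ : C(Y, Y))) g ▸ hlim))
      _ (isCompact_closedBall y (R + 1))
    filter_upwards [Metric.tendstoUniformlyOn_iff.1 hlim' (δ / 2) (half_pos hδ),
      hs'.eventually (hε0.eventually (gt_mem_nhds (half_pos hδ))),
      hs'.eventually (hε0.eventually (gt_mem_nhds one_pos)),
      hs'.eventually (hinv.eventually_gt_atTop (R + 1))] with j hunif hεδ hε1 hεR x hx
    have hγdom : (r (κ (s j)))⁻¹ * dist (act (γ (κ (s j))) p) p < 1 / ε (s j) := by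
      rw [hone]; linarith
    have hxdom : (r (κ (s j)))⁻¹ * dist x p < 1 / ε (s j) := by linarith
    have hγx : (r (κ (s j)))⁻¹ * dist (act (γ (κ (s j))) x) p < 1 / ε (s j) := by
      have h1 := mul_le_mul_of_nonneg_left
        (dist_triangle (act (γ (κ (s j))) x) (act (γ (κ (s j))) p) p)
        (inv_nonneg.2 (hrpos (κ (s j))).le)
      rw [mul_add, hone, (h.isometry _).dist_eq] at h1
      linarith
    have hfx : (A (s j)).f x ∈ Metric.closedBall y (R + 1) := by
      have h1 := abs_lt.1 ((A (s j)).almost_isometric _ _ hxdom (hbase _))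
      rw [(A (s j)).map_base] at h1
      exact Metric.mem_closedBall.2 (by linarith)
    have h1 := (A (s j)).φ_equivariant _ _ hγdom hxdom hγx
    have h2 : dist (g ((A (s j)).f x)) ((A (s j)).φ (γ (κ (s j))) ((A (s j)).f x)) < δ / 2 :=
      hunif _ hfx
    rw [dist_comm] at h2
    linarith [dist_triangle ((A (s j)).f (act (γ (κ (s j))) x))
      ((A (s j)).φ (γ (κ (s j))) ((A (s j)).f x)) (g ((A (s j)).f x))]

/-- Let `α` belong to the subgroup generated by the predecessors of a short generator `γ i`. If an
approximation of the space rescaled by `(r i)⁻¹` maps the orbit points of `α` and `β` to points at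
distance at most `1 - e`, then `β` belongs to that subgroup as well. -/
theorem mem_closure_of_dist_lt (h : IsIsometricRightAction act)
    (hγ : IsShortGenerators (fun δ => dist (act δ p) p) γ)
    (hr : ∀ i, r i = dist (act (γ i) p) p) (hrpos : ∀ i, 0 < r i) {i : ℕ} {e : ℝ}
    (A : EquivariantApprox (r i)⁻¹ act p G y e) {α β : Γ}
    (hα : α ∈ Subgroup.closure (γ '' Iio i)) (hαdom : (r i)⁻¹ * dist (act α p) p < 1 / e)
    (hβdom : (r i)⁻¹ * dist (act β p) p < 1 / e)
    (hdist : dist (A.f (act α p)) (A.f (act β p)) + e ≤ 1) :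
    β ∈ Subgroup.closure (γ '' Iio i) := by
  by_contra hβ
  have h1 : r i ≤ dist (act α p) (act β p) := by
    rw [hr, h.dist_act_act]
    exact (hγ i).2 _ fun hmem => hβ (by simpa using mul_mem hmem hα)
  have h2 : 1 ≤ (r i)⁻¹ * dist (act α p) (act β p) := by
    rw [inv_mul_eq_div]
    exact (one_le_div (hrpos i)).2 h1
  linarith [(abs_lt.1 (A.almost_isometric _ _ hαdom hβdom)).1]

/-- Let `γ (κ j)` be short generators converging to `g`, and let `S` be a connected part of the
orbit of `y` that contains `y`. Then `g y` has distance at least `1` from `S`: otherwise one could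
walk from `y` to `g y` in steps of length less than `1`, and lift the walk to one of elements of
`Γ` which would never leave the subgroup generated by the predecessors of `γ (κ j)`. -/
theorem one_le_dist_of_isPreconnected (h : IsIsometricRightAction act)
    (hγ : IsShortGenerators (fun δ => dist (act δ p) p) γ)
    (hr : ∀ i, r i = dist (act (γ i) p) p) (hrpos : ∀ i, 0 < r i)
    (hε : ∀ j, 0 < ε j) (hε0 : Tendsto ε atTop (𝓝 0))
    (A : ∀ j, EquivariantApprox (r (κ j))⁻¹ act p G y (ε j)) {g : Y ≃ᵢ Y}
    (hconv : ElementsConverge A (fun j => γ (κ j)) g) {S : Set Y} (hS : IsPreconnected S)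
    (hSG : S ⊆ isometryOrbit (G : Set (Y ≃ᵢ Y)) y) (hy : y ∈ S) {z : Y} (hz : z ∈ S) :
    1 ≤ dist (g y) z := by
  have hinv : Tendsto (fun j => 1 / ε j) atTop atTop := by
    simp only [one_div]
    exact (tendsto_nhdsWithin_iff.2 ⟨hε0, Eventually.of_forall hε⟩).inv_tendsto_nhdsGT_zero
  have hbase : ∀ j, (r (κ j))⁻¹ * dist p p < 1 / ε j := fun j => by simpa using hε j
  -- The points of `S` are limits of orbit points of the subgroups generated by predecessors.
  have hlimit : ∀ δ > 0, ∀ᶠ j in atTop, ∃ α ∈ Subgroup.closure (γ '' Iio (κ j)),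
      (r (κ j))⁻¹ * dist (act α p) p < 1 / ε j ∧ dist ((A j).f (act α p)) z < δ := by
    refine hS.induction_dist_lt one_pos (P := fun z => ∀ δ > 0, ∀ᶠ j in atTop,
      ∃ α ∈ Subgroup.closure (γ '' Iio (κ j)),
        (r (κ j))⁻¹ * dist (act α p) p < 1 / ε j ∧ dist ((A j).f (act α p)) z < δ) hy ?_ ?_ hz
    · refine fun δ hδ => Eventually.of_forall fun j => ⟨1, one_mem _, ?_, ?_⟩
      · rw [h.one]
        exact hbase j
      · rwa [h.one, (A j).map_base, dist_self]
    · intro u _ v hv huv hu δ hδ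
      -- If `v = k y` with `k ∈ G`, the elements `ψ j k` have orbit points converging to `v`.
      obtain ⟨k, hk, rfl⟩ := hSG hv
      have hgap : 0 < (1 - dist u (k y)) / 3 := by linarith
      filter_upwards [hu _ hgap, hε0.eventually (gt_mem_nhds hgap),
        hε0.eventually (gt_mem_nhds hδ), hinv.eventually_gt_atTop (dist (k y) y)]
        with j ⟨α, hα, hαdom, hαu⟩ hεgap hεδ hkdom
      have hψdom := (A j).ψ_mem k hk hkdom
      have hψ := (A j).ψ_equivariant k hk p hkdom (hbase j) hψdom
      rw [(A j).map_base] at hψ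
      refine ⟨(A j).ψ k, h.mem_closure_of_dist_lt hγ hr hrpos (A j) hα hαdom hψdom ?_, hψdom,
        hψ.trans hεδ⟩
      have h1 := dist_triangle4 ((A j).f (act α p)) u (k y) ((A j).f (act ((A j).ψ k) p))
      rw [dist_comm (k y) ((A j).f _)] at h1
      linarith
  by_contra! hlt
  have hgap : 0 < (1 - dist (g y) z) / 3 := by linarith
  have hg := hconv 1 one_pos _ hgap
  obtain ⟨j, ⟨α, hα, hαdom, hαz⟩, hgj, hεgap, hlarge⟩ := ((hlimit _ hgap).and (hg.and
    ((hε0.eventually (gt_mem_nhds hgap)).and (hinv.eventually_gt_atTop 1)))).exists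
  have hgp := hgj p (by simp)
  rw [(A j).map_base] at hgp
  refine (hγ (κ j)).1 (h.mem_closure_of_dist_lt hγ hr hrpos (A j) hα hαdom ?_ ?_)
  · rwa [← hr, inv_mul_cancel₀ (hrpos _).ne']
  · have h1 := dist_triangle4 ((A j).f (act α p)) z (g y) ((A j).f (act (γ (κ j)) p))
    rw [dist_comm (g y) ((A j).f _), dist_comm z (g y)] at h1
    linarith

end IsIsometricRightAction

/-! ### Orbits of connected sets of isometries -/

theorem isPreconnected_isometryOrbit {Y : Type*} [MetricSpace Y] {S : Set (Y ≃ᵢ Y)}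
    (hS : IsPreconnected S) (y : Y) : IsPreconnected (isometryOrbit S y) := by
  have hcont : Continuous fun g : Y ≃ᵢ Y => (⟨g, g.continuous⟩ : C(Y, Y)) := continuous_induced_dom
  exact hS.image _ ((continuous_eval_const y).comp hcont).continuousOn

/-! ### The action of the fundamental group by path lifting -/

section Deck

namespace IsCoveringMap

/-- Monodromy does not see a change of the names of the endpoints. -/
theorem coe_monodromy_cast {X E : Type*} [TopologicalSpace X] [TopologicalSpace E] {p : E → X}
    (cov : IsCoveringMap p) {x x' z z' : X} (γ : Path.Homotopic.Quotient x z) (hx : x' = x)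
    (hz : z' = z) (e : p ⁻¹' {x'}) (e' : p ⁻¹' {x}) (he : (e : E) = e') :
    (cov.monodromy (γ.cast hx hz) e : E) = cov.monodromy γ e' := by
  subst hx hz
  rw [Path.Homotopic.Quotient.cast_rfl_rfl, Subtype.ext he]

end IsCoveringMap

theorem Path.Homotopic.Quotient.map_eq_cast_of_eq {X Z : Type*} [TopologicalSpace X]
    [TopologicalSpace Z] {x y : X} (α : Path.Homotopic.Quotient x y) {f g : C(X, Z)} (h : f = g) :
    α.map f = (α.map g).cast congr($h x) congr($h y) := by
  subst h
  rw [Path.Homotopic.Quotient.cast_rfl_rfl]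

variable {M M' : Type*} [TopologicalSpace M] [TopologicalSpace M'] [SimplyConnectedSpace M']
    {pr : M' → M} (hpr : IsCoveringMap pr) (p' : M')

theorem map_deckAct (γ : FundamentalGroup M (pr p')) (x : M') :
    pr (deckAct hpr p' γ x) = pr x :=
  (hpr.monodromy _ _).2

/-- The action does not depend on the path used to define it. -/
theorem deckAct_eq_monodromy (γ : FundamentalGroup M (pr p')) {x : M'}
    (α : Path.Homotopic.Quotient p' x) :
    deckAct hpr p' γ x
      = hpr.monodromy (γ.toPath.trans (α.map ⟨pr, hpr.continuous⟩)) ⟨p', rfl⟩ := by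
  rw [deckAct, Subsingleton.elim α (.mk (PathConnectedSpace.somePath p' x))]

theorem deckAct_base (γ : FundamentalGroup M (pr p')) :
    deckAct hpr p' γ p' = hpr.monodromy γ.toPath ⟨p', rfl⟩ := by
  rw [deckAct_eq_monodromy hpr p' γ (.refl p')]
  change (hpr.monodromy (γ.toPath.trans (.refl (pr p'))) ⟨p', rfl⟩ : M') = _
  rw [Path.Homotopic.Quotient.trans_refl]

theorem deckAct_one (x : M') : deckAct hpr p' 1 x = x := by
  rw [deckAct, hpr.monodromy_trans_apply]
  change (hpr.monodromy _ (hpr.monodromy (.refl _) _) : M') = x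
  rw [hpr.monodromy_refl, id, hpr.monodromy_map]

/-- Products act in reverse order, as their factors are concatenated in reverse order. -/
theorem deckAct_mul (a b : FundamentalGroup M (pr p')) (x : M') :
    deckAct hpr p' (a * b) x = deckAct hpr p' b (deckAct hpr p' a x) := by
  let α : Path.Homotopic.Quotient p' x := .mk (PathConnectedSpace.somePath p' x)
  let w := a.toPath.trans (α.map ⟨pr, hpr.continuous⟩)
  -- The lift of the path defining `a · x` may be used to define `b · (a · x)`.
  let η : Path.Homotopic.Quotient p' (deckAct hpr p' a x) := hpr.liftPathQuotient w ⟨p', rfl⟩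
  have hη : η.map ⟨pr, hpr.continuous⟩ = w.cast rfl (map_deckAct hpr p' a x) :=
    hpr.map_liftPathQuotient w ⟨p', rfl⟩
  have hright : deckAct hpr p' b (deckAct hpr p' a x)
      = hpr.monodromy w (hpr.monodromy b.toPath ⟨p', rfl⟩) := by
    rw [deckAct_eq_monodromy hpr p' b η, hη, hpr.monodromy_trans_apply]
    exact hpr.coe_monodromy_cast _ _ _ _ _ rfl
  rw [hright, deckAct_eq_monodromy hpr p' (a * b) α, ← hpr.monodromy_trans_apply,
    ← Path.Homotopic.Quotient.trans_assoc]
  rfl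

/-- The action is free at the base point: a loop with a closed lift is null homotopic. -/
theorem eq_one_of_deckAct_eq (γ : FundamentalGroup M (pr p')) (h : deckAct hpr p' γ p' = p') :
    γ = 1 := by
  rw [deckAct_base] at h
  let Γ := (hpr.liftPathQuotient γ.toPath ⟨p', rfl⟩).cast rfl h.symm
  have hΓ : Γ.map ⟨pr, hpr.continuous⟩ = γ.toPath := by
    rw [Path.Homotopic.Quotient.map_cast, hpr.map_liftPathQuotient]
    exact (γ.toPath.cast_cast _ _ _ _).trans γ.toPath.cast_rfl_rfl
  rw [Subsingleton.elim Γ (.refl p')] at hΓ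
  exact hΓ.symm

/-- The element `γ` acts as the continuous lift of `pr` through itself that maps `p'` to `γ · p'`;
it exists because `M'` is simply connected. -/
theorem continuous_deckAct [LocallyPathConnectedSpace M'] (γ : FundamentalGroup M (pr p')) :
    Continuous (deckAct hpr p' γ) := by
  obtain ⟨F, ⟨hF0, hF⟩, -⟩ := hpr.existsUnique_continuousMap_lifts ⟨pr, hpr.continuous⟩ p'
    (deckAct hpr p' γ p') (map_deckAct hpr p' γ p')
  -- The lift `F` of `pr` maps a path from `p'` to `x` to the path defining `γ · x`.
  suffices hFx : ∀ x, deckAct hpr p' γ x = F x from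
    (funext hFx : deckAct hpr p' γ = F) ▸ F.continuous
  intro x
  let α : Path.Homotopic.Quotient p' x := .mk (PathConnectedSpace.somePath p' x)
  have hstart : hpr.monodromy γ.toPath ⟨p', rfl⟩ = ⟨F p', congr_fun hF p'⟩ :=
    Subtype.ext ((deckAct_base hpr p' γ).symm.trans hF0.symm)
  have hend : hpr.monodromy (α.map ⟨pr, hpr.continuous⟩) ⟨F p', congr_fun hF p'⟩
      = ⟨F x, congr_fun hF x⟩ := by
    refine hpr.monodromy_eq_of_map_eq (α.map F) ?_
    rw [← Path.Homotopic.Quotient.map_comp]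
    exact α.map_eq_cast_of_eq (ContinuousMap.ext (congr_fun hF))
  rw [deckAct_eq_monodromy hpr p' γ α, hpr.monodromy_trans_apply, hstart, hend]

end Deck

/-! ### Lifts of a Riemannian covering through itself are isometric -/

section Riemannian

open Manifold

variable {n : ℕ} {M M' : Type*}
    [TopologicalSpace M] [ChartedSpace (EuclideanSpace ℝ (Fin n)) M]
    [MetricSpace M'] [ChartedSpace (EuclideanSpace ℝ (Fin n)) M']

/-- A continuous lift of a local diffeomorphism through a local diffeomorphism is smooth. -/
theorem contMDiff_of_comp_eq {pr : M' → M} (hpr : IsLocalDiffeomorph (𝓡 n) (𝓡 n) ∞ pr)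
    {T : M' → M'} (hT : Continuous T) (hprT : ∀ x, pr (T x) = pr x) :
    ContMDiff (𝓡 n) (𝓡 n) ∞ T := by
  intro x
  have hloc := hpr (T x)
  have hsmooth : ContMDiffAt (𝓡 n) (𝓡 n) ∞ (hloc.localInverse ∘ pr) x := by
    refine ContMDiffAt.comp x ?_ (hpr x).contMDiffAt
    rw [← hprT x]
    exact hloc.localInverse_contMDiffAt
  refine hsmooth.congr_of_eventuallyEq ?_
  filter_upwards [hT.continuousAt.eventually hloc.localInverse_eventuallyEq_left] with z hz
  rw [Function.comp_apply, ← hprT z]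
  exact hz.symm

variable [RiemannianBundle (fun x : M => TangentSpace (𝓡 n) x)]
    [RiemannianBundle (fun x : M' => TangentSpace (𝓡 n) x)]

theorem norm_mfderiv_of_comp_eq {pr : M' → M} (hpr : IsRiemannianCovering n pr)
    {T : M' → M'} (hT : Continuous T) (hprT : ∀ x, pr (T x) = pr x) (x : M')
    (v : TangentSpace (𝓡 n) x) : ‖mfderiv (𝓡 n) (𝓡 n) T x v‖ = ‖v‖ := by
  have hTx := (contMDiff_of_comp_eq hpr.isLocalDiffeomorph hT hprT).mdifferentiable (by simp) x
  have hprx := hpr.isLocalDiffeomorph.mdifferentiable (by simp) (T x)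
  have hcomp := mfderiv_comp x hprx hTx
  -- The tangent spaces at `pr (T x)` and `pr x` are different types, so `pr ∘ T` is replaced by `pr`
  -- in a statement that does not mention the values.
  have hfun : ∀ f : M' → M, f = pr → ‖mfderiv (𝓡 n) (𝓡 n) f x v‖ = ‖v‖ := by
    rintro _ rfl
    exact hpr.norm_mfderiv x v
  rw [← hfun _ (funext hprT : pr ∘ T = pr), hcomp]
  exact (hpr.norm_mfderiv (T x) _).symm

/-- A continuous lift of a Riemannian covering through itself preserves the length of paths. -/
theorem edist_le_of_comp_eq [IsRiemannianManifold (𝓡 n) M']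
    {pr : M' → M} (hpr : IsRiemannianCovering n pr)
    {T : M' → M'} (hT : Continuous T) (hprT : ∀ x, pr (T x) = pr x) (x z : M') :
    edist (T x) (T z) ≤ edist x z := by
  rw [IsRiemannianManifold.out (I := 𝓡 n) (T x) (T z), IsRiemannianManifold.out (I := 𝓡 n) x z]
  refine le_of_forall_gt fun ρ hρ => ?_
  obtain ⟨c, hc0, hc1, hc, hlen⟩ := exists_lt_of_riemannianEDist_lt hρ
  have hsmooth := contMDiff_of_comp_eq hpr.isLocalDiffeomorph hT hprT
  refine lt_of_le_of_lt (riemannianEDist_le_pathELength (γ := T ∘ c) (a := 0) (b := 1)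
    ((hsmooth.of_le (by simp)).comp_contMDiffOn hc) (by simp [hc0]) (by simp [hc1]) zero_le_one) ?_
  refine lt_of_le_of_lt (le_of_eq ?_) hlen
  rw [pathELength_eq_lintegral_mfderiv_Ioo, pathELength_eq_lintegral_mfderiv_Ioo]
  refine MeasureTheory.setLIntegral_congr_fun measurableSet_Ioo fun t ht => ?_
  have hct : MDifferentiableAt 𝓘(ℝ, ℝ) (𝓡 n) c t :=
    (hc.contMDiffAt (Icc_mem_nhds ht.1 ht.2)).mdifferentiableAt one_ne_zero
  have hTc := mfderiv_comp t (hsmooth.mdifferentiable (by simp) (c t)) hct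
  have hnorm := norm_mfderiv_of_comp_eq hpr hT hprT (c t) (mfderiv 𝓘(ℝ, ℝ) (𝓡 n) c t 1)
  rw [hTc, ← ofReal_norm, ← ofReal_norm, ← hnorm]
  rfl

/-- The fundamental group acts by isometries on the Riemannian universal cover: each element and
its inverse are short maps. -/
theorem isIsometricRightAction_deckAct [IsRiemannianManifold (𝓡 n) M'] [SimplyConnectedSpace M']
    {pr : M' → M} (hpr : IsRiemannianCovering n pr) (p' : M') :
    IsIsometricRightAction (deckAct hpr.isCoveringMap p') where
  one := deckAct_one hpr.isCoveringMap p'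
  mul := deckAct_mul hpr.isCoveringMap p'
  isometry a := by
    have : LocallyPathConnectedSpace M' :=
      ChartedSpace.locallyPathConnectedSpace (EuclideanSpace ℝ (Fin n)) M'
    have hle : ∀ b x z, edist (deckAct hpr.isCoveringMap p' b x) (deckAct hpr.isCoveringMap p' b z)
        ≤ edist x z := fun b =>
      edist_le_of_comp_eq hpr (continuous_deckAct hpr.isCoveringMap p' b)
        (map_deckAct hpr.isCoveringMap p' b)
    refine fun x z => le_antisymm (hle a x z) ?_
    have hinv := hle a⁻¹ (deckAct hpr.isCoveringMap p' a x) (deckAct hpr.isCoveringMap p' a z)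
    rwa [← deckAct_mul, ← deckAct_mul, mul_inv_cancel, deckAct_one, deckAct_one] at hinv

end Riemannian

theorem mainTheorem5 {n : ℕ}
    -- `M` is an open (complete, noncompact, connected, without boundary) Riemannian `n`-manifold
    {M : Type*} [MetricSpace M] [ChartedSpace (EuclideanSpace ℝ (Fin n)) M]
    [IsManifold (𝓡 n) ∞ M]
    [RiemannianBundle (fun x : M => TangentSpace (𝓡 n) x)]
    [IsContMDiffRiemannianBundle (𝓡 n) ∞ (EuclideanSpace ℝ (Fin n))
      (fun x : M => TangentSpace (𝓡 n) x)]
    [IsRiemannianManifold (𝓡 n) M]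
    [ConnectedSpace M] [CompleteSpace M] [NoncompactSpace M]
    (hRic : RicciNonneg n M)
    -- `pr : M' → M` is its Riemannian universal cover, with base points `p'` and `p = pr p'`
    {M' : Type*} [MetricSpace M'] [ChartedSpace (EuclideanSpace ℝ (Fin n)) M']
    [IsManifold (𝓡 n) ∞ M']
    [RiemannianBundle (fun x : M' => TangentSpace (𝓡 n) x)]
    [IsContMDiffRiemannianBundle (𝓡 n) ∞ (EuclideanSpace ℝ (Fin n))
      (fun x : M' => TangentSpace (𝓡 n) x)]
    [IsRiemannianManifold (𝓡 n) M'] [SimplyConnectedSpace M']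
    (pr : M' → M) (hpr : IsRiemannianCovering n pr) (p' : M')
    -- infinitely many short generators of `π₁(M, p)`, and their displacements `r i`
    (γ : ℕ → FundamentalGroup M (pr p'))
    (hγ : IsShortGenerators (fun δ => dist (deckAct hpr.isCoveringMap p' δ p') p') γ)
    (r : ℕ → ℝ) (hr : ∀ i, r i = dist (deckAct hpr.isCoveringMap p' (γ i) p') p')
    -- equivariant convergence of a subsequence of `((r i)⁻¹ M', p', π₁(M, p))` to `(Y, y, G)`
    {Y : Type*} [MetricSpace Y] [ProperSpace Y] (y : Y)
    (G : Subgroup (Y ≃ᵢ Y)) (hG : IsClosed (G : Set (Y ≃ᵢ Y)))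
    (k : ℕ → ℕ) (hk : StrictMono k)
    (ε : ℕ → ℝ) (hε : ∀ j, 0 < ε j) (hε0 : Tendsto ε atTop (𝓝 0))
    (A : ∀ j, EquivariantApprox (r (k j))⁻¹ (deckAct hpr.isCoveringMap p') p' G y (ε j)) :
    Tendsto r atTop atTop ∧
    ¬ IsConnected (isometryOrbit (G : Set (Y ≃ᵢ Y)) y) ∧
    (∃ s : ℕ → ℕ, StrictMono s ∧ ∃ g ∈ G,
      ElementsConverge (fun j => A (s j)) (fun j => γ (k (s j))) g) ∧
    (∀ s : ℕ → ℕ, StrictMono s → ∀ g ∈ G,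
      ElementsConverge (fun j => A (s j)) (fun j => γ (k (s j))) g →
      1 ≤ Metric.infDist (g y) (isometryOrbit (identityComponent G) y)) := by
  have hact := isIsometricRightAction_deckAct hpr p'
  have hmono : Monotone r := fun i j hij => by
    rw [hr, hr]
    exact hγ.monotone hij
  have hr0 : 0 < r 0 := by
    rw [hr, dist_pos]
    intro hfix
    exact (hγ 0).1 (eq_one_of_deckAct_eq hpr.isCoveringMap p' _ hfix ▸ one_mem _)
  have hrpos : ∀ i, 0 < r i := fun i => hr0.trans_le (hmono (Nat.zero_le i))
  have hfar : ∀ s : ℕ → ℕ, StrictMono s → ∀ g : Y ≃ᵢ Y,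
      ElementsConverge (fun j => A (s j)) (fun j => γ (k (s j))) g → ∀ S : Set Y,
      IsPreconnected S → S ⊆ isometryOrbit (G : Set (Y ≃ᵢ Y)) y → y ∈ S → ∀ z ∈ S,
      1 ≤ dist (g y) z := fun s hs g hconv S hS hSG hy z hz =>
    hact.one_le_dist_of_isPreconnected (κ := fun j => k (s j)) hγ hr hrpos (fun j => hε (s j))
      (hε0.comp hs.tendsto_atTop) (fun j => A (s j)) hconv hS hSG hy hz
  have hsub := hact.exists_subseq_elementsConverge hr hrpos hG hε hε0 A
  refine ⟨hact.tendsto_displacement_atTop hγ hr hr0 hε hε0 A, fun hconn => ?_, hsub,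
    fun s hs g _ hconv => ?_⟩
  · -- A connected orbit would itself be a connected set containing `y` and the limit `g y`.
    obtain ⟨s, hs, g, hg, hconv⟩ := hsub
    have h1 := hfar s hs g hconv _ hconn.isPreconnected Subset.rfl ⟨1, one_mem G, rfl⟩ (g y)
      ⟨g, hg, rfl⟩
    rw [dist_self] at h1
    exact absurd h1 (by norm_num)
  · have hone : (1 : Y ≃ᵢ Y) ∈ identityComponent G := mem_connectedComponentIn (one_mem G)
    have hy : y ∈ isometryOrbit (identityComponent G) y := ⟨1, hone, rfl⟩
    refine (Metric.le_infDist ⟨y, hy⟩).2 fun {z} hz => hfar s hs g hconv _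
      (isPreconnected_isometryOrbit isPreconnected_connectedComponentIn y)
      (image_mono (connectedComponentIn_subset _ _)) hy z hz
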